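/- Let $n,p\ge 0$, let $f:\mathbb R^n\to\mathbb R^n$ be invertible and $h:\mathbb R^n\to\mathbb R^p$ be such that $f^{-1}$ and $h$ are of class $C^1$ and globally Lipschitz on $\mathbb R^n$ (Euclidean norms). Write $f^{-i}=(f^{-1})^i$ for the iterates of $f^{-1}$. Let $\mathcal X\subset\mathbb R^n$ be backward distinguishable: for all $x_1\ne x_2$ in $\mathcal X$ there is an integer $i\ge 1$ with $h(f^{-i}(x_1))\neq h(f^{-i}(x_2))$. Let $\mathcal Y\subset\mathbb R^n$ be a set that contains $\mathcal X$, is backward stable, i.e. $f^{-1}(x)\in\mathcal Y$ for all $x\in\mathcal Y$, and is either convex, or open and connected. (One may always take $\mathcal Y=\mathbb R^n$; one may take $\mathcal Y=\mathcal X$ if $\mathcal X$ itself is backward stable and either convex, or open and connected.) Put $$C_2=\sup\{\|(f^{-1})'(x)\| : x\in\mathcal Y\}<\infty,$$ with the matrix norm induced by the Euclidean norm, and let $\mathcal D\subset\mathbb C$ be the open disc centred at $0$ of radius $\min\{1,1/C_2\}$ (with $1/0=\infty$). Let $m=(n+1)p$ and $B=(1,\dots,1)^*\otimes I_p\in\mathbb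 C^{m\times p}$ (with $n+1$ ones). Then there is a set $\mathcal R\subset\mathcal D^{n+1}$ of zero Lebesgue measure in $\mathbb C^{n+1}$ such that, for every $(\lambda_1,\dots,\lambda_{n+1})\in\mathcal D^{n+1}\setminus\mathcal R$ and for $A=\operatorname{diag}(\lambda_1,\dots,\lambda_{n+1})\otimes I_p\in\mathbb C^{m\times m}$, the series $$T(x)=\sum_{i=0}^{+\infty}A^iB\,h(f^{-(i+1)}(x))\in\mathbb C^m$$ converges (absolutely) for every $x\in\mathcal Y$, the map $T$ is of class $C^1$ on $\mathcal Y$ (hence on $\mathcal X$), and $T$ is injective on $\mathcal X$. -/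

import Mathlib

open scoped Kronecker ENNReal
open MeasureTheory

noncomputable section

/-- Backward distinguishability on `X` of the system `x_{k+1} = f x_k`, `y_k = h x_k`: two distinct
points of `X` have different outputs at some backward time `-i`, `i ≥ 1`. -/
def BackwardDistinguishable {n p : ℕ}
    (f : EuclideanSpace ℝ (Fin n) ≃ EuclideanSpace ℝ (Fin n))
    (h : EuclideanSpace ℝ (Fin n) → EuclideanSpace ℝ (Fin p))
    (X : Set (EuclideanSpace ℝ (Fin n))) : Prop :=
  ∀ x₁ ∈ X, ∀ x₂ ∈ X, x₁ ≠ x₂ → ∃ i : ℕ, 0 < i ∧ h (f.symm^[i] x₁) ≠ h (f.symm^[i] x₂)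

/-- `sup {|(f⁻¹)'(x)| : x ∈ Y}` for the operator norm induced by the Euclidean norm, as an
extended nonnegative real. -/
def inverseDerivSup {n : ℕ} (f : EuclideanSpace ℝ (Fin n) ≃ EuclideanSpace ℝ (Fin n))
    (Y : Set (EuclideanSpace ℝ (Fin n))) : ℝ≥0∞ :=
  ⨆ x ∈ Y, ‖fderiv ℝ f.symm x‖ₑ

/-- The open disc of `ℂ` centred at `0` of radius `min {1, 1 / C}`, where `1 / 0 = ∞`. -/
def openDisc (C : ℝ≥0∞) : Set ℂ := Metric.eball 0 (min 1 (1 / C))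

/-- `A = diag(l_1, …, l_{n+1}) ⊗ I_p`, a square complex matrix of size `(n+1)p`. -/
def matA (n p : ℕ) (l : Fin (n + 1) → ℂ) :
    Matrix (Fin ((n + 1) * p)) (Fin ((n + 1) * p)) ℂ :=
  Matrix.reindex finProdFinEquiv finProdFinEquiv
    (Matrix.diagonal l ⊗ₖ (1 : Matrix (Fin p) (Fin p) ℂ))

/-- `B = (1, …, 1)^* ⊗ I_p`, a complex matrix of size `(n+1)p × p`. -/
def matB (n p : ℕ) : Matrix (Fin ((n + 1) * p)) (Fin p) ℂ :=
  Matrix.reindex finProdFinEquiv (Equiv.uniqueProd (Fin p) (Fin 1))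
    ((Matrix.of fun (_ : Fin 1) (_ : Fin (n + 1)) => (1 : ℂ)).conjTranspose ⊗ₖ
      (1 : Matrix (Fin p) (Fin p) ℂ))

/-- A real vector seen as a complex one. -/
def complexify {p : ℕ} (y : EuclideanSpace ℝ (Fin p)) : Fin p → ℂ := fun j => (y j : ℂ)

/-- The `i`-th term `A^i B h(f^{-(i+1)}(x))` of the series that defines `T`. -/
def seriesTerm {n p m : ℕ} (f : EuclideanSpace ℝ (Fin n) ≃ EuclideanSpace ℝ (Fin n))
    (h : EuclideanSpace ℝ (Fin n) → EuclideanSpace ℝ (Fin p))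
    (A : Matrix (Fin m) (Fin m) ℂ) (B : Matrix (Fin m) (Fin p) ℂ)
    (x : EuclideanSpace ℝ (Fin n)) (i : ℕ) : EuclideanSpace ℂ (Fin m) :=
  WithLp.toLp 2 ((A ^ i * B).mulVec (complexify (h (f.symm^[i + 1] x))))

/-- `T(x) = ∑_{i ≥ 0} A^i B h(f^{-(i+1)}(x))` (meaningful where the series converges). -/
def mapT {n p m : ℕ} (f : EuclideanSpace ℝ (Fin n) ≃ EuclideanSpace ℝ (Fin n))
    (h : EuclideanSpace ℝ (Fin n) → EuclideanSpace ℝ (Fin p))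
    (A : Matrix (Fin m) (Fin m) ℂ) (B : Matrix (Fin m) (Fin p) ℂ)
    (x : EuclideanSpace ℝ (Fin n)) : EuclideanSpace ℂ (Fin m) :=
  ∑' i : ℕ, seriesTerm f h A B x i

end

/-! Since `A` is diagonal, coordinate `(k, j)` of `T x` is a scalar power series in `l k` whose
coefficients are the `j`-th outputs along the backward orbit of `x`. Hence `T x₁ = T x₂` exactly
when every `l k` is a common zero of the functions `F j (x₁, x₂)`, the power series of output
differences. By distinguishability one of them is not identically zero when `x₁ ≠ x₂`, so its zeros
have finite order.

The bad tuples are shown to be null by counting dimensions. A zero of finite order is a simple zero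
of some iterated derivative, and simple zeros move in a Lipschitz way with the pair
(`dist_zeros_le`). After a countable stratification by derivative orders, the bad tuples depend
locally Lipschitz-continuously on a pair with `2n` real parameters, so their Hausdorff dimension is
at most `2n < 2(n+1)`, the real dimension of the space of tuples (`volume_common_zeros_eq_zero`).

Convergence and smoothness on `|z| < 1/C`, with `C = max 1 C₂`, come from outputs growing like
`(i+1) C ^ i` and their derivatives like `C ^ i`. -/

open Metric Set Filter Topology

/-! ### Holomorphic families with Lipschitz parameters -/

/-- A family of functions `F x`, `x ∈ s`, holomorphic on `U` and locally Lipschitz in `x`, locally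
uniformly on `U`. -/
structure HolomorphicLipschitz {V : Type*} [PseudoMetricSpace V] (F : V → ℂ → ℂ) (U : Set ℂ)
    (s : Set V) : Prop where
  differentiableOn : ∀ x ∈ s, DifferentiableOn ℂ (F x) U
  lipschitz : ∀ x ∈ s, ∀ z ∈ U, ∃ t ∈ 𝓝[s] x, ∃ r > 0, ∃ K : ℝ, 0 ≤ K ∧
    ∀ a ∈ t, ∀ b ∈ t, ∀ w ∈ ball z r, ‖F a w - F b w‖ ≤ K * dist a b

namespace HolomorphicLipschitz

variable {V : Type*} [PseudoMetricSpace V] {F : V → ℂ → ℂ} {U : Set ℂ} {s : Set V}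

/-- Cauchy's estimate on a small circle bounds the derivative of `F a - F b`, at the cost of a
factor `1 / ρ`. -/
theorem deriv (hF : HolomorphicLipschitz F U s) (hU : IsOpen U) :
    HolomorphicLipschitz (fun x => deriv (F x)) U s := by
  refine ⟨fun x hx => (hF.differentiableOn x hx).deriv hU, fun x hx z hz => ?_⟩
  obtain ⟨t, ht, r, hr, K, hK, hlip⟩ := hF.lipschitz x hx z hz
  obtain ⟨r', hr', hball⟩ := Metric.isOpen_iff.1 hU z hz
  obtain ⟨ρ, hρ, hρr, hρr'⟩ : ∃ ρ > 0, 3 * ρ ≤ r ∧ 3 * ρ ≤ r' :=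
    ⟨min r r' / 3, by positivity, by linarith [min_le_left r r'], by linarith [min_le_right r r']⟩
  refine ⟨t ∩ s, inter_mem ht self_mem_nhdsWithin, ρ, hρ, K / ρ, by positivity, ?_⟩
  intro a ha b hb w hw
  have hsub : closedBall w ρ ⊆ ball z (3 * ρ) := fun y hy => by
    have := dist_triangle y w z
    rw [mem_closedBall] at hy
    rw [mem_ball] at hw ⊢
    linarith
  have hwU : w ∈ U := hball (ball_subset_ball hρr' (hsub (mem_closedBall_self hρ.le)))
  have hda := hF.differentiableOn a ha.2
  have hdb := hF.differentiableOn b hb.2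
  have hd : DifferentiableOn ℂ (fun w => F a w - F b w) U := hda.sub hdb
  have hcl : closedBall w ρ ⊆ U := fun y hy => hball (ball_subset_ball hρr' (hsub hy))
  have hdc : DiffContOnCl ℂ (fun w => F a w - F b w) (ball w ρ) :=
    (hd.mono hcl).diffContOnCl_ball (subset_refl _)
  have := Complex.norm_deriv_le_of_forall_mem_sphere_norm_le (C := K * dist a b) hρ hdc
    (fun y hy => hlip a ha.1 b hb.1 y (ball_subset_ball hρr (hsub (sphere_subset_closedBall hy))))
  rw [deriv_fun_sub (hda.differentiableAt (hU.mem_nhds hwU))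
    (hdb.differentiableAt (hU.mem_nhds hwU))] at this
  calc _ ≤ K * dist a b / ρ := this
    _ = _ := by ring

theorem iterate_deriv (hF : HolomorphicLipschitz F U s) (hU : IsOpen U) (m : ℕ) :
    HolomorphicLipschitz (fun x => _root_.deriv^[m] (F x)) U s := by
  induction m with
  | zero => exact hF
  | succ m ih => simpa only [Function.iterate_succ_apply'] using ih.deriv hU

theorem mono (hF : HolomorphicLipschitz F U s) {s' : Set V} (hs : s' ⊆ s) :
    HolomorphicLipschitz F U s' := by
  refine ⟨fun x hx => hF.differentiableOn x (hs hx), fun x hx z hz => ?_⟩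
  obtain ⟨t, ht, h⟩ := hF.lipschitz x (hs hx) z hz
  exact ⟨t, nhdsWithin_mono _ hs ht, h⟩

/-- Near a simple zero, the zeros of the members of the family depend on the parameter in a
Lipschitz way. -/
theorem dist_zeros_le (hF : HolomorphicLipschitz F U s) (hU : IsOpen U) {x : V} (hx : x ∈ s)
    {z : ℂ} (hz : z ∈ U) (hd : _root_.deriv (F x) z ≠ 0) :
    ∃ t ∈ 𝓝[s] x, ∃ r > 0, ∃ K : ℝ, 0 ≤ K ∧ ∀ a ∈ t, ∀ b ∈ t, ∀ v ∈ ball z r, ∀ w ∈ ball z r,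
      F a v = 0 → F b w = 0 → dist v w ≤ K * dist a b := by
  obtain ⟨t, ht, r, hr, K, hK, hlip⟩ := hF.lipschitz x hx z hz
  obtain ⟨t', ht', r', hr', K', hK', hlip'⟩ := (hF.deriv hU).lipschitz x hx z hz
  set D := _root_.deriv (F x) z with hD
  have hDpos : 0 < ‖D‖ := norm_pos_iff.2 hd
  have hcont : ContinuousAt (_root_.deriv (F x)) z :=
    (((hF.differentiableOn x hx).deriv hU).differentiableAt (hU.mem_nhds hz)).continuousAt
  obtain ⟨r₁, hr₁, hball₁⟩ := Metric.isOpen_iff.1 hU z hz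
  obtain ⟨r₂, hr₂, hball₂⟩ := Metric.continuousAt_iff.1 hcont (‖D‖ / 4) (by positivity)
  set ρ := min (min r r') (min r₁ r₂) with hρdef
  have hρ : 0 < ρ := by positivity
  have hρ1 : ρ ≤ r := (min_le_left _ _).trans (min_le_left _ _)
  have hρ2 : ρ ≤ r' := (min_le_left _ _).trans (min_le_right _ _)
  have hρ3 : ρ ≤ r₁ := (min_le_right _ _).trans (min_le_left _ _)
  have hρ4 : ρ ≤ r₂ := (min_le_right _ _).trans (min_le_right _ _)
  -- This radius makes `K' * dist a x ≤ ‖D‖ / 4`; the `+ 1` covers `K' = 0`.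
  have hnear : ball x (‖D‖ / (4 * (K' + 1))) ∈ 𝓝[s] x :=
    mem_nhdsWithin_of_mem_nhds (ball_mem_nhds _ (by positivity))
  refine ⟨t ∩ (t' ∩ (ball x (‖D‖ / (4 * (K' + 1))) ∩ s)),
    inter_mem ht (inter_mem ht' (inter_mem hnear self_mem_nhdsWithin)), ρ, hρ,
    2 * K / ‖D‖, by positivity, ?_⟩
  rintro a ⟨hat, hat', hax, has⟩ b ⟨hbt, -⟩ v hv w hw hav hbw
  have hxt' : x ∈ t' := mem_of_mem_nhdsWithin hx ht'
  have hbound : ∀ y ∈ ball z ρ, ‖_root_.deriv (F a) y - D‖ ≤ ‖D‖ / 2 := by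
    intro y hy
    have h1 := hlip' a hat' x hxt' y (ball_subset_ball hρ2 hy)
    have h2 := hball₂ (ball_subset_ball hρ4 hy)
    rw [dist_eq_norm] at h2
    have h3 : K' * dist a x ≤ ‖D‖ / 4 := by
      rw [mem_ball, lt_div_iff₀ (by positivity)] at hax
      nlinarith [dist_nonneg (x := a) (y := x)]
    calc ‖_root_.deriv (F a) y - D‖
        = ‖(_root_.deriv (F a) y - _root_.deriv (F x) y) + (_root_.deriv (F x) y - D)‖ := by
          rw [sub_add_sub_cancel]
      _ ≤ _ := norm_add_le _ _
      _ ≤ ‖D‖ / 2 := by linarith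
  -- `F a` is linear with slope `D` up to a `‖D‖ / 2`-Lipschitz error, so `‖w - v‖` is controlled by
  -- `F a w - F a v`, which equals `F a w - F b w` at the two zeros.
  have hmv : ‖(F a w - D * w) - (F a v - D * v)‖ ≤ ‖D‖ / 2 * ‖w - v‖ := by
    refine (convex_ball z ρ).norm_image_sub_le_of_norm_hasDerivWithin_le
      (f := fun y => F a y - D * y) (f' := fun y => _root_.deriv (F a) y - D)
      (fun y hy => ?_) hbound hv hw
    have h1 : HasDerivAt (F a) (_root_.deriv (F a) y) y :=
      ((hF.differentiableOn a has).differentiableAt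
        (hU.mem_nhds (hball₁ (ball_subset_ball hρ3 hy)))).hasDerivAt
    simpa using (h1.fun_sub ((hasDerivAt_id' y).const_mul D)).hasDerivWithinAt
  have hl := hlip a hat b hbt w (ball_subset_ball hρ1 hw)
  rw [hbw, sub_zero] at hl
  rw [hav] at hmv
  have h4 : ‖D‖ * ‖w - v‖ ≤ ‖F a w‖ + ‖D‖ / 2 * ‖w - v‖ := by
    calc ‖D‖ * ‖w - v‖ = ‖D * (w - v)‖ := (norm_mul _ _).symm
      _ = ‖F a w - ((F a w - D * w) - (0 - D * v))‖ := by congr 1; ring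
      _ ≤ _ := (norm_sub_le _ _).trans (by gcongr)
  rw [dist_comm v w, dist_eq_norm w v, div_mul_eq_mul_div, le_div_iff₀ hDpos]
  linarith

end HolomorphicLipschitz

/-! ### Hausdorff dimension of the set of common zeros -/

/-- A set whose projection to the first factor is locally antilipschitz has at most the dimension
of the first factor, and so does its projection to the second factor. -/
theorem dimH_image_snd_le {V W : Type*} [NormedAddCommGroup V] [NormedSpace ℝ V]
    [FiniteDimensional ℝ V] [MetricSpace W] [SecondCountableTopology W] (S : Set (V × W))
    (hS : ∀ q ∈ S, ∃ t ∈ 𝓝[S] q, ∃ K : ℝ, 0 ≤ K ∧ ∀ a ∈ t, ∀ b ∈ t,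
      dist a.2 b.2 ≤ K * dist a.1 b.1) :
    dimH (Prod.snd '' S) ≤ Module.finrank ℝ V := by
  have : ProperSpace V := FiniteDimensional.proper_real V
  refine (LipschitzWith.prod_snd.dimH_image_le S).trans ?_
  by_contra! hlt
  obtain ⟨q, hq, hdim⟩ := exists_mem_nhdsWithin_lt_dimH_of_lt_dimH hlt
  obtain ⟨t, ht, K, hK, h⟩ := hS q hq
  refine (hdim t ht).not_ge ?_
  have hanti : AntilipschitzWith (max 1 K.toNNReal) (fun a : t => a.1.1) := by
    refine AntilipschitzWith.of_le_mul_dist fun a b => ?_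
    rw [Subtype.dist_eq, Prod.dist_eq]
    refine max_le ?_ ((h a a.2 b b.2).trans ?_)
    · exact le_mul_of_one_le_left dist_nonneg (by simp)
    · gcongr
      simp
  have h1 := hanti.le_dimH_image univ
  have h2 : dimH (univ : Set t) = dimH t := by
    rw [← isometry_subtype_coe.dimH_image, image_univ, Subtype.range_coe]
  rw [h2] at h1
  exact h1.trans ((dimH_mono (subset_univ _)).trans (Real.dimH_univ_eq_finrank V).le)

/-- If the members of a holomorphic Lipschitz family with `d` real parameters have only isolated
zeros, the tuples of `N` common zeros of the members form a null set as soon as `d < 2 N`. -/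
theorem volume_common_zeros_eq_zero {V : Type*} [NormedAddCommGroup V] [NormedSpace ℝ V]
    [FiniteDimensional ℝ V] {ι : Type*} [Countable ι] {F : ι → V → ℂ → ℂ} {U : Set ℂ}
    {s : Set V} (hF : ∀ j, HolomorphicLipschitz (F j) U s) (hU : IsOpen U)
    (hfin : ∀ x ∈ s, ∃ j, ∀ z ∈ U, ∃ m, deriv^[m] (F j x) z ≠ 0) (N : ℕ)
    (hN : Module.finrank ℝ V < 2 * N) :
    volume {l : Fin N → ℂ | (∀ k, l k ∈ U) ∧ ∃ x ∈ s, ∀ j k, F j x (l k) = 0} = 0 := by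
  -- Stratum `(j, m)`: each `q.2 k` is a simple zero of the `m k`-th derivative of `F j q.1`.
  set S : ι × (Fin N → ℕ) → Set (V × (Fin N → ℂ)) := fun i =>
    {q | q.1 ∈ s ∧ ∀ k, q.2 k ∈ U ∧ deriv^[i.2 k] (F i.1 q.1) (q.2 k) = 0 ∧
      deriv^[i.2 k + 1] (F i.1 q.1) (q.2 k) ≠ 0} with hSdef
  have hsub : {l : Fin N → ℂ | (∀ k, l k ∈ U) ∧ ∃ x ∈ s, ∀ j k, F j x (l k) = 0} ⊆
      ⋃ i, Prod.snd '' S i := by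
    rintro l ⟨hlU, x, hx, hzero⟩
    obtain ⟨j, hj⟩ := hfin x hx
    have : ∀ k, ∃ m, deriv^[m] (F j x) (l k) = 0 ∧ deriv^[m + 1] (F j x) (l k) ≠ 0 := by
      intro k
      -- Otherwise vanishing propagates from each derivative to the next, and the zero has infinite
      -- order.
      by_contra! hcon
      obtain ⟨m, hm⟩ := hj (l k) (hlU k)
      refine hm ?_
      clear hm
      induction m with
      | zero => exact hzero j k
      | succ m ih => exact hcon m ih
    choose m hm using this
    exact mem_iUnion.2 ⟨(j, m), (x, l), ⟨hx, fun k => ⟨hlU k, hm k⟩⟩, rfl⟩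
  have hdim : dimH (⋃ i, Prod.snd '' S i) ≤ Module.finrank ℝ V := by
    rw [dimH_iUnion]
    refine iSup_le fun i => dimH_image_snd_le _ ?_
    rintro ⟨x, l⟩ ⟨hx, hl⟩
    have hloc : ∀ k, ∃ t ∈ 𝓝[s] x, ∃ r > 0, ∃ K : ℝ, 0 ≤ K ∧ ∀ a ∈ t, ∀ b ∈ t,
        ∀ v ∈ ball (l k) r, ∀ w ∈ ball (l k) r, deriv^[i.2 k] (F i.1 a) v = 0 →
        deriv^[i.2 k] (F i.1 b) w = 0 → dist v w ≤ K * dist a b := fun k =>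
      ((hF i.1).iterate_deriv hU (i.2 k)).dist_zeros_le hU hx (hl k).1 (by
        simpa only [Function.iterate_succ_apply'] using (hl k).2.2)
    choose t ht r hr K hK h using hloc
    refine ⟨{q | q ∈ S i ∧ (q.1 ∈ ⋂ k, t k) ∧ ∀ k, q.2 k ∈ ball (l k) (r k)}, ?_, ∑ k, K k,
      Finset.sum_nonneg fun k _ => hK k, ?_⟩
    · have h1 : ∀ᶠ q : V × (Fin N → ℂ) in 𝓝[S i] (x, l), q.1 ∈ ⋂ k, t k := by
        have : Tendsto Prod.fst (𝓝[S i] (x, l)) (𝓝[s] x) :=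
          tendsto_nhdsWithin_of_tendsto_nhds_of_eventually_within _
            (continuous_fst.continuousAt.tendsto.mono_left nhdsWithin_le_nhds)
            (eventually_nhdsWithin_of_forall fun q hq => hq.1)
        exact this (Filter.iInter_mem.2 ht)
      have h2 : ∀ᶠ q : V × (Fin N → ℂ) in 𝓝[S i] (x, l), ∀ k, q.2 k ∈ ball (l k) (r k) := by
        refine eventually_all.2 fun k => nhdsWithin_le_nhds ?_
        have hc : Continuous fun q : V × (Fin N → ℂ) => q.2 k := by fun_prop
        exact hc.continuousAt (ball_mem_nhds _ (hr k))
      filter_upwards [self_mem_nhdsWithin, h1, h2] with q ha hb hc using ⟨ha, hb, hc⟩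
    · rintro a ⟨haS, hat, har⟩ b ⟨hbS, hbt, hbr⟩
      have hKsum : 0 ≤ ∑ k, K k := Finset.sum_nonneg fun k _ => hK k
      refine (dist_pi_le_iff (by positivity)).2 fun k => ?_
      refine (h k _ (mem_iInter.1 hat k) _ (mem_iInter.1 hbt k) _ (har k) _ (hbr k)
        (haS.2 k).2.1 (hbS.2 k).2.1).trans ?_
      gcongr
      exact Finset.single_le_sum (f := K) (fun k _ => hK k) (Finset.mem_univ k)
  have hfr : Module.finrank ℝ (Fin N → ℂ) = 2 * N := by
    rw [Module.finrank_pi_fintype]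
    simp [Complex.finrank_real_complex, mul_comm]
  refine measure_mono_null hsub (measure_zero_of_dimH_lt (d := ((2 * N : ℕ) : NNReal)) ?_ ?_)
  -- Lebesgue measure is a Haar measure, hence absolutely continuous with respect to the Hausdorff
  -- measure of dimension `2 * N`.
  · have h : (volume : Measure (Fin N → ℂ)) ≪ μH[(Module.finrank ℝ (Fin N → ℂ) : ℝ)] :=
      Measure.absolutelyContinuous_isAddHaarMeasure _ _
    rw [hfr] at h
    simpa using h
  · refine hdim.trans_lt ?_
    exact_mod_cast hN

/-! ### Power series with coefficients of size `(i+1) C ^ i` -/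

section PowerSeries

variable {a : ℕ → ℂ} {C M : ℝ}

theorem summable_norm_pow_mul_of_le (hC : 0 < C) (ha : ∀ i, ‖a i‖ ≤ M * (i + 1) * C ^ i) {z : ℂ}
    (hz : z ∈ ball (0 : ℂ) (1 / C)) : Summable fun i => ‖z ^ i * a i‖ := by
  rw [mem_ball_zero_iff, lt_div_iff₀ hC] at hz
  have hq : ‖‖z‖ * C‖ < 1 := by rwa [Real.norm_of_nonneg (by positivity)]
  have h1 : Summable fun i : ℕ => M * ((i : ℝ) ^ 1 * (‖z‖ * C) ^ i + (‖z‖ * C) ^ i) :=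
    ((summable_pow_mul_geometric_of_norm_lt_one 1 hq).add
      (summable_geometric_of_norm_lt_one hq)).mul_left M
  refine h1.of_nonneg_of_le (fun i => norm_nonneg _) fun i => ?_
  rw [norm_mul, norm_pow]
  calc ‖z‖ ^ i * ‖a i‖ ≤ ‖z‖ ^ i * (M * (i + 1) * C ^ i) := by gcongr; exact ha i
    _ = _ := by rw [mul_pow]; ring

theorem hasFPowerSeriesOnBall_tsum_of_le (hC : 0 < C)
    (ha : ∀ i, ‖a i‖ ≤ M * (i + 1) * C ^ i) :
    HasFPowerSeriesOnBall (fun z => ∑' i, z ^ i * a i) (FormalMultilinearSeries.ofScalars ℂ a) 0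
      (ENNReal.ofReal (1 / C)) := by
  set p := FormalMultilinearSeries.ofScalars ℂ a
  have hrad : ENNReal.ofReal (1 / C) ≤ p.radius := by
    refine ENNReal.le_of_forall_nnreal_lt fun r hr => p.le_radius_of_summable_norm ?_
    have hr' : (r : ℝ) < 1 / C := by
      rwa [← ENNReal.ofReal_coe_nnreal, ENNReal.ofReal_lt_ofReal_iff (by positivity)] at hr
    have := summable_norm_pow_mul_of_le hC ha (z := ((r : ℝ) : ℂ)) (by simpa using hr')
    refine this.congr fun i => ?_
    rw [FormalMultilinearSeries.ofScalars_norm]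
    simp [mul_comm]
  have hpos : 0 < ENNReal.ofReal (1 / C) := by simpa using hC
  have hfun : p.sum = fun z => ∑' i, z ^ i * a i := by
    have := FormalMultilinearSeries.ofScalarsSum_eq_tsum (E := ℂ) (c := a)
    simpa [FormalMultilinearSeries.ofScalarsSum, mul_comm] using this
  rw [← hfun]
  exact (p.hasFPowerSeriesOnBall (hpos.trans_le hrad)).mono hpos hrad

theorem analyticOnNhd_tsum_of_le (hC : 0 < C) (ha : ∀ i, ‖a i‖ ≤ M * (i + 1) * C ^ i) :
    AnalyticOnNhd ℂ (fun z => ∑' i, z ^ i * a i) (ball 0 (1 / C)) := by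
  simpa [Metric.eball_ofReal] using (hasFPowerSeriesOnBall_tsum_of_le hC ha).analyticOnNhd

/-- A power series with a nonzero coefficient vanishes to finite order everywhere. -/
theorem exists_iterate_deriv_tsum_ne_zero (hC : 0 < C)
    (ha : ∀ i, ‖a i‖ ≤ M * (i + 1) * C ^ i) {k : ℕ} (hk : a k ≠ 0) {z : ℂ}
    (hz : z ∈ ball (0 : ℂ) (1 / C)) : ∃ m, deriv^[m] (fun z => ∑' i, z ^ i * a i) z ≠ 0 := by
  by_contra! hzero
  have han := analyticOnNhd_tsum_of_le hC ha
  -- Infinite order at one point forces vanishing on the whole disc by the identity theorem, hence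
  -- zero coefficients at `0`.
  have htop : analyticOrderAt (fun z => ∑' i, z ^ i * a i) z = ⊤ := by
    refine ENat.eq_top_iff_forall_ge.2 fun n => ?_
    refine (natCast_le_analyticOrderAt_iff_iteratedDeriv_eq_zero (han z hz)).2 fun i _ => ?_
    rw [iteratedDeriv_eq_iterate]
    exact hzero i
  have heq := han.eqOn_zero_of_preconnected_of_eventuallyEq_zero
    (convex_ball _ _).isPreconnected hz (analyticOrderAt_eq_top.1 htop)
  have hev : (fun z => ∑' i, z ^ i * a i) =ᶠ[𝓝 0] 0 :=
    heq.eventuallyEq_of_mem (ball_mem_nhds _ (by positivity))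
  have hp := ((hasFPowerSeriesOnBall_tsum_of_le hC ha).hasFPowerSeriesAt.congr hev).eq_zero
  exact hk (congrFun ((FormalMultilinearSeries.ofScalars_series_eq_zero ℂ).1 hp) k)

end PowerSeries

/-- A power series whose coefficients depend on a parameter in a Lipschitz way is a holomorphic
Lipschitz family. -/
theorem holomorphicLipschitz_tsum {V : Type*} [PseudoMetricSpace V] {s : Set V} {a : V → ℕ → ℂ}
    {C : ℝ} (hC : 0 < C) (hgrowth : ∀ x ∈ s, ∃ M : ℝ, ∀ i : ℕ, ‖a x i‖ ≤ M * (i + 1) * C ^ i)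
    (hlip : ∀ x ∈ s, ∃ t ∈ 𝓝[s] x, ∃ K : ℝ, 0 ≤ K ∧ ∀ y ∈ t, ∀ y' ∈ t, ∀ i,
      ‖a y i - a y' i‖ ≤ K * C ^ i * dist y y') :
    HolomorphicLipschitz (fun x z => ∑' i, z ^ i * a x i) (ball 0 (1 / C)) s := by
  refine ⟨fun x hx => ?_, fun x hx z hz => ?_⟩
  · obtain ⟨M, hM⟩ := hgrowth x hx
    exact (analyticOnNhd_tsum_of_le hC hM).differentiableOn
  obtain ⟨t, ht, K, hK, hl⟩ := hlip x hx
  rw [mem_ball_zero_iff] at hz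
  -- An intermediate radius gives one geometric ratio `ρ * C < 1` for all `w` near `z`.
  obtain ⟨ρ, hzρ, hρ⟩ := exists_between hz
  have hρ0 : 0 ≤ ρ := (norm_nonneg z).trans hzρ.le
  have hρC : ρ * C < 1 := by rwa [lt_div_iff₀ hC] at hρ
  refine ⟨t ∩ s, inter_mem ht self_mem_nhdsWithin, ρ - ‖z‖, sub_pos.2 hzρ, K * (1 - ρ * C)⁻¹,
    mul_nonneg hK (inv_nonneg.2 (by linarith)), ?_⟩
  rintro y ⟨hyt, hys⟩ y' ⟨hyt', hys'⟩ w hw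
  have hwρ : ‖w‖ ≤ ρ := by
    have := norm_sub_norm_le w z
    rw [mem_ball, dist_eq_norm] at hw
    linarith
  have hwball : w ∈ ball (0 : ℂ) (1 / C) := mem_ball_zero_iff.2 (hwρ.trans_lt hρ)
  obtain ⟨M, hM⟩ := hgrowth y hys
  obtain ⟨M', hM'⟩ := hgrowth y' hys'
  rw [← (summable_norm_pow_mul_of_le hC hM hwball).of_norm.tsum_sub
    (summable_norm_pow_mul_of_le hC hM' hwball).of_norm]
  have hgeom := (hasSum_geometric_of_lt_one (by positivity) hρC).mul_left (K * dist y y')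
  refine (tsum_of_norm_bounded hgeom fun i => ?_).trans_eq (by ring)
  rw [← mul_sub, norm_mul, norm_pow]
  calc ‖w‖ ^ i * ‖a y i - a y' i‖ ≤ ρ ^ i * (K * C ^ i * dist y y') := by
        gcongr
        exact hl y hyt y' hyt' i
    _ = _ := by rw [mul_pow]; ring

/-! ### Termwise differentiation of series -/

/-- A series of `C¹` functions with summably bounded derivatives is `C¹` on a locally convex set. -/
theorem contDiffOn_one_tsum {E G : Type*} [NormedAddCommGroup E] [NormedSpace ℝ E]
    [NormedAddCommGroup G] [NormedSpace ℝ G] [CompleteSpace G] {u : ℕ → E → G} {b : ℕ → ℝ}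
    {Y : Set E} (hu : ∀ i, ContDiff ℝ 1 (u i)) (hb : Summable b)
    (hbound : ∀ i, ∀ x ∈ Y, ‖fderiv ℝ (u i) x‖ ≤ b i)
    (hsum : ∀ x ∈ Y, Summable fun i => u i x)
    (hconv : ∀ x ∈ Y, ∃ t ∈ 𝓝[Y] x, t ⊆ Y ∧ Convex ℝ t) :
    ContDiffOn ℝ 1 (fun x => ∑' i, u i x) Y := by
  have hdiff : ∀ i x, DifferentiableAt ℝ (u i) x := fun i x =>
    (hu i).differentiable one_ne_zero x
  -- `Y` may have empty interior, where derivatives within `Y` are not unique; the sum of the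
  -- ambient derivatives serves as an explicit one.
  rw [← zero_add (1 : WithTop ℕ∞), contDiffOn_succ_iff_hasFDerivWithinAt (by simp)]
  intro x hx
  obtain ⟨t, ht, htY, htc⟩ := hconv x hx
  refine ⟨t, by rwa [insert_eq_of_mem hx], by simp, fun x => ∑' i, fderiv ℝ (u i) x, ?_, ?_⟩
  · intro x hxt
    have hxY := htY hxt
    have hsumd : Summable fun i => fderiv ℝ (u i) x := hb.of_norm_bounded fun i => hbound i x hxY
    rw [hasFDerivWithinAt_iff_tendsto]
    -- Dominated convergence for the difference quotients: the mean value inequality on the convex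
    -- `t` bounds the `i`-th one by `2 * b i`.
    have hdom : Tendsto (fun y => ∑' i, ‖y - x‖⁻¹ • (u i y - u i x - fderiv ℝ (u i) x (y - x)))
        (𝓝[t] x) (𝓝 (∑' _ : ℕ, (0 : G))) := by
      refine tendsto_tsum_of_dominated_convergence (hb.mul_left 2) (fun i => ?_) ?_
      · have := hasFDerivWithinAt_iff_tendsto.1
          ((hdiff i x).hasFDerivAt.hasFDerivWithinAt (s := t))
        rw [tendsto_zero_iff_norm_tendsto_zero]
        simpa [norm_smul] using this
      · filter_upwards [self_mem_nhdsWithin] with y hy i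
        have h1 : ‖u i y - u i x‖ ≤ b i * ‖y - x‖ :=
          htc.norm_image_sub_le_of_norm_fderiv_le (fun w _ => hdiff i w)
            (fun w hw => hbound i w (htY hw)) hxt hy
        have h2 : ‖fderiv ℝ (u i) x (y - x)‖ ≤ b i * ‖y - x‖ :=
          (ContinuousLinearMap.le_opNorm _ _).trans (by gcongr; exact hbound i x hxY)
        have hb0 : 0 ≤ b i := (norm_nonneg _).trans (hbound i x hxY)
        rw [norm_smul, norm_inv, norm_norm]
        calc ‖y - x‖⁻¹ * ‖u i y - u i x - fderiv ℝ (u i) x (y - x)‖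
            ≤ ‖y - x‖⁻¹ * (2 * b i * ‖y - x‖) := by
              gcongr
              exact (norm_sub_le _ _).trans (by linarith)
          _ = 2 * b i * (‖y - x‖⁻¹ * ‖y - x‖) := by ring
          _ ≤ 2 * b i * 1 := by gcongr; exact inv_mul_le_one
          _ = _ := mul_one _
    rw [tsum_zero] at hdom
    refine (tendsto_zero_iff_norm_tendsto_zero.1 hdom).congr' ?_
    filter_upwards [self_mem_nhdsWithin] with y hy
    have happ : Summable fun i => fderiv ℝ (u i) x (y - x) := hsumd.mapL
      (ContinuousLinearMap.apply ℝ G (y - x))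
    have hev : (∑' i, fderiv ℝ (u i) x) (y - x) = ∑' i, fderiv ℝ (u i) x (y - x) :=
      (ContinuousLinearMap.apply ℝ G (y - x)).map_tsum hsumd
    rw [tsum_const_smul'', norm_smul, norm_inv, norm_norm,
      ((hsum y (htY hy)).sub (hsum x hxY)).tsum_sub happ,
      (hsum y (htY hy)).tsum_sub (hsum x hxY), hev]
  · rw [contDiffOn_zero]
    exact continuousOn_tsum (fun i => ((hu i).continuous_fderiv one_ne_zero).continuousOn) hb
      fun i x hx => hbound i x (htY hx)

/-! ### Growth and regularity along backward orbits -/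

section Iterates

variable {E : Type*} [NormedAddCommGroup E] [NormedSpace ℝ E] {g : E → E} {Y : Set E} {C : ℝ}

theorem contDiff_iterate (hg : ContDiff ℝ 1 g) (i : ℕ) : ContDiff ℝ 1 g^[i] := by
  induction i with
  | zero => exact contDiff_id
  | succ i ih => exact ih.comp hg

theorem norm_fderiv_iterate_le (hg : Differentiable ℝ g) (hY : MapsTo g Y Y)
    (hC : ∀ x ∈ Y, ‖fderiv ℝ g x‖ ≤ C) (i : ℕ) : ∀ x ∈ Y, ‖fderiv ℝ g^[i] x‖ ≤ C ^ i := by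
  induction i with
  | zero =>
    intro x _
    simpa using ContinuousLinearMap.norm_id_le (𝕜 := ℝ) (E := E)
  | succ i ih =>
    intro x hx
    have : 0 ≤ C := (norm_nonneg _).trans (hC x hx)
    rw [Function.iterate_succ, fderiv_comp x ((hg.iterate i) _) (hg x), pow_succ]
    exact (ContinuousLinearMap.opNorm_comp_le _ _).trans
      (mul_le_mul (ih _ (hY hx)) (hC x hx) (norm_nonneg _) (by positivity))

theorem norm_iterate_sub_iterate_le (hg : Differentiable ℝ g) (hY : MapsTo g Y Y)
    (hC : ∀ x ∈ Y, ‖fderiv ℝ g x‖ ≤ C) {t : Set E} (ht : Convex ℝ t) (htY : t ⊆ Y) (i : ℕ)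
    {x y : E} (hx : x ∈ t) (hy : y ∈ t) : ‖g^[i] y - g^[i] x‖ ≤ C ^ i * ‖y - x‖ :=
  ht.norm_image_sub_le_of_norm_fderiv_le (fun w _ => hg.iterate i w)
    (fun w hw => norm_fderiv_iterate_le hg hY hC i w (htY hw)) hx hy

/-- The bound holds locally by convexity, and it is a symmetric and transitive relation between
points, so connectedness spreads it to all of `Y`. The constant `M` depends on the pair. -/
theorem exists_norm_iterate_sub_iterate_le (hg : Differentiable ℝ g) (hY : MapsTo g Y Y)
    (hC : ∀ x ∈ Y, ‖fderiv ℝ g x‖ ≤ C) (hpre : IsPreconnected Y)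
    (hconv : ∀ x ∈ Y, ∃ t ∈ 𝓝[Y] x, t ⊆ Y ∧ Convex ℝ t) {x y : E} (hx : x ∈ Y) (hy : y ∈ Y) :
    ∃ M : ℝ, 0 ≤ M ∧ ∀ i, ‖g^[i] y - g^[i] x‖ ≤ M * C ^ i := by
  refine hpre.induction₂ (fun x y => ∃ M : ℝ, 0 ≤ M ∧ ∀ i, ‖g^[i] y - g^[i] x‖ ≤ M * C ^ i)
    ?_ ?_ ?_ hx hy
  · intro x hx
    obtain ⟨t, ht, htY, htc⟩ := hconv x hx
    filter_upwards [ht] with y hy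
    exact ⟨‖y - x‖, norm_nonneg _, fun i => (norm_iterate_sub_iterate_le hg hY hC htc htY i
      (mem_of_mem_nhdsWithin hx ht) hy).trans_eq (mul_comm _ _)⟩
  · rintro x y z - - - ⟨M, hM, h⟩ ⟨M', hM', h'⟩
    refine ⟨M + M', by positivity, fun i => ?_⟩
    have := norm_add_le (g^[i] z - g^[i] y) (g^[i] y - g^[i] x)
    rw [sub_add_sub_cancel] at this
    linarith [h i, h' i]
  · rintro x y - - ⟨M, hM, h⟩
    exact ⟨M, hM, fun i => by rw [norm_sub_rev]; exact h i⟩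

/-- Telescoping along the orbit: each step is the bound for the pair `x`, `g x`. The factor `i`
counts the steps and is harmless inside the disc of convergence. -/
theorem exists_norm_iterate_sub_le (hg : Differentiable ℝ g) (hY : MapsTo g Y Y)
    (hC : ∀ x ∈ Y, ‖fderiv ℝ g x‖ ≤ C) (hC1 : 1 ≤ C) (hpre : IsPreconnected Y)
    (hconv : ∀ x ∈ Y, ∃ t ∈ 𝓝[Y] x, t ⊆ Y ∧ Convex ℝ t) {x : E} (hx : x ∈ Y) :
    ∃ M : ℝ, 0 ≤ M ∧ ∀ i : ℕ, ‖g^[i] x - x‖ ≤ M * i * C ^ i := by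
  obtain ⟨M, hM, h⟩ := exists_norm_iterate_sub_iterate_le hg hY hC hpre hconv hx (hY hx)
  refine ⟨M, hM, fun i => ?_⟩
  induction i with
  | zero => simp
  | succ i ih =>
    have h1 := norm_add_le (g^[i] (g x) - g^[i] x) (g^[i] x - x)
    rw [sub_add_sub_cancel] at h1
    rw [Function.iterate_succ_apply]
    calc _ ≤ M * C ^ i + M * i * C ^ i := h1.trans (add_le_add (h i) ih)
      _ = M * (i + 1) * C ^ i := by ring
      _ ≤ M * (i + 1) * C ^ (i + 1) := by gcongr; simp
      _ = _ := by push_cast; rfl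

variable {η : E → ℂ} {L : NNReal}

/-- The outputs along a backward orbit grow at most like `i C ^ i`. -/
theorem exists_norm_output_le (hg : Differentiable ℝ g) (hY : MapsTo g Y Y)
    (hC : ∀ x ∈ Y, ‖fderiv ℝ g x‖ ≤ C) (hC1 : 1 ≤ C) (hpre : IsPreconnected Y)
    (hconv : ∀ x ∈ Y, ∃ t ∈ 𝓝[Y] x, t ⊆ Y ∧ Convex ℝ t) (hη : LipschitzWith L η) {x : E}
    (hx : x ∈ Y) : ∃ M : ℝ, ∀ i : ℕ, ‖η (g^[i + 1] x)‖ ≤ M * (i + 1) * C ^ i := by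
  obtain ⟨M, hM, h⟩ := exists_norm_iterate_sub_le hg hY hC hC1 hpre hconv hx
  refine ⟨‖η x‖ + L * M * C, fun i => ?_⟩
  have h1 : ‖η (g^[i + 1] x)‖ ≤ ‖η x‖ + ‖η (g^[i + 1] x) - η x‖ := by
    simpa using norm_add_le (η x) (η (g^[i + 1] x) - η x)
  have h2 := hη.norm_sub_le (g^[i + 1] x) x
  -- Lets the constant `‖η x‖` be absorbed into the growth rate.
  have h3 : 1 ≤ ((i : ℝ) + 1) * C ^ i :=
    one_le_mul_of_one_le_of_one_le (by simp) (one_le_pow₀ hC1)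
  calc ‖η (g^[i + 1] x)‖ ≤ ‖η x‖ * 1 + L * (M * (i + 1 : ℕ) * C ^ (i + 1)) := by
        rw [mul_one]
        exact h1.trans (by gcongr; exact h2.trans (by gcongr; exact h _))
    _ ≤ ‖η x‖ * ((i + 1) * C ^ i) + L * (M * (i + 1 : ℕ) * C ^ (i + 1)) := by gcongr
    _ = _ := by push_cast; ring

/-- The scalar components of the observer map are `C¹`. -/
theorem contDiffOn_tsum_output (hg : ContDiff ℝ 1 g) (hY : MapsTo g Y Y)
    (hC : ∀ x ∈ Y, ‖fderiv ℝ g x‖ ≤ C) (hC1 : 1 ≤ C) (hpre : IsPreconnected Y)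
    (hconv : ∀ x ∈ Y, ∃ t ∈ 𝓝[Y] x, t ⊆ Y ∧ Convex ℝ t) (hη : LipschitzWith L η)
    (hη' : ContDiff ℝ 1 η) {z : ℂ} (hz : z ∈ ball (0 : ℂ) (1 / C)) :
    ContDiffOn ℝ 1 (fun x => ∑' i, z ^ i * η (g^[i + 1] x)) Y := by
  have hgd : Differentiable ℝ g := hg.differentiable one_ne_zero
  have hηd : Differentiable ℝ η := hη'.differentiable one_ne_zero
  have hC0 : 0 < C := zero_lt_one.trans_le hC1
  have hzC : ‖z‖ * C < 1 := by rwa [mem_ball_zero_iff, lt_div_iff₀ hC0] at hz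
  have hcomp : ∀ i, ContDiff ℝ 1 fun x => η (g^[i + 1] x) := fun i =>
    hη'.comp (contDiff_iterate hg (i + 1))
  refine contDiffOn_one_tsum (b := fun i => L * C * (‖z‖ * C) ^ i)
    (fun i => contDiff_const.mul (hcomp i))
    ((summable_geometric_of_lt_one (by positivity) hzC).mul_left _) (fun i x hx => ?_)
    (fun x hx => ?_) hconv
  · rw [fderiv_const_mul ((hcomp i).differentiable one_ne_zero x), norm_smul, norm_pow]
    have h1 : fderiv ℝ (fun x => η (g^[i + 1] x)) x =
        (fderiv ℝ η (g^[i + 1] x)).comp (fderiv ℝ g^[i + 1] x) :=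
      fderiv_comp x (hηd _) (hgd.iterate (i + 1) x)
    rw [h1]
    calc _ ≤ ‖z‖ ^ i * (L * C ^ (i + 1)) := by
          gcongr
          refine (ContinuousLinearMap.opNorm_comp_le _ _).trans ?_
          gcongr
          · exact norm_fderiv_le_of_lipschitz ℝ hη
          · exact norm_fderiv_iterate_le hgd hY hC _ x hx
      _ = _ := by rw [mul_pow]; ring
  · obtain ⟨M, hM⟩ := exists_norm_output_le hgd hY hC hC1 hpre hconv hη hx
    exact (summable_norm_pow_mul_of_le hC0 hM hz).of_norm

/-- The differences of the outputs along two backward orbits generate a holomorphic Lipschitz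
family. -/
theorem holomorphicLipschitz_output_sub (hg : Differentiable ℝ g) (hY : MapsTo g Y Y)
    (hC : ∀ x ∈ Y, ‖fderiv ℝ g x‖ ≤ C) (hC1 : 1 ≤ C) (hpre : IsPreconnected Y)
    (hconv : ∀ x ∈ Y, ∃ t ∈ 𝓝[Y] x, t ⊆ Y ∧ Convex ℝ t) (hη : LipschitzWith L η) :
    HolomorphicLipschitz
      (fun (x : E × E) z => ∑' i, z ^ i * (η (g^[i + 1] x.1) - η (g^[i + 1] x.2)))
      (ball 0 (1 / C)) (Y ×ˢ Y) := by
  have hC0 : 0 < C := zero_lt_one.trans_le hC1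
  refine holomorphicLipschitz_tsum
    (a := fun (x : E × E) i => η (g^[i + 1] x.1) - η (g^[i + 1] x.2)) hC0 ?_ ?_
  · rintro x ⟨hx₁, hx₂⟩
    obtain ⟨M₁, h₁⟩ := exists_norm_output_le hg hY hC hC1 hpre hconv hη hx₁
    obtain ⟨M₂, h₂⟩ := exists_norm_output_le hg hY hC hC1 hpre hconv hη hx₂
    exact ⟨M₁ + M₂, fun i => (norm_sub_le _ _).trans
      ((add_le_add (h₁ i) (h₂ i)).trans_eq (by ring))⟩
  · rintro ⟨x₁, x₂⟩ ⟨hx₁, hx₂⟩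
    obtain ⟨t₁, ht₁, htY₁, htc₁⟩ := hconv x₁ hx₁
    obtain ⟨t₂, ht₂, htY₂, htc₂⟩ := hconv x₂ hx₂
    refine ⟨t₁ ×ˢ t₂, by rw [nhdsWithin_prod_eq]; exact prod_mem_prod ht₁ ht₂, 2 * L * C,
      by positivity, ?_⟩
    rintro ⟨y₁, y₂⟩ ⟨hy₁, hy₂⟩ ⟨w₁, w₂⟩ ⟨hw₁, hw₂⟩ i
    have key : ∀ {t : Set E}, t ⊆ Y → Convex ℝ t → ∀ y ∈ t, ∀ w ∈ t,
        ‖η (g^[i + 1] y) - η (g^[i + 1] w)‖ ≤ L * (C ^ (i + 1) * dist y w) := by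
      intro t htY htc y hy w hw
      rw [dist_eq_norm]
      exact (hη.norm_sub_le _ _).trans
        (by gcongr; exact norm_iterate_sub_iterate_le hg hY hC htc htY _ hw hy)
    have h₁ := key htY₁ htc₁ y₁ hy₁ w₁ hw₁
    have h₂ := key htY₂ htc₂ y₂ hy₂ w₂ hw₂
    have hd₁ : dist y₁ w₁ ≤ dist (y₁, y₂) (w₁, w₂) := le_max_left _ _
    have hd₂ : dist y₂ w₂ ≤ dist (y₁, y₂) (w₁, w₂) := le_max_right _ _
    calc _ = ‖(η (g^[i + 1] y₁) - η (g^[i + 1] w₁)) - (η (g^[i + 1] y₂) - η (g^[i + 1] w₂))‖ := by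
          congr 1; ring
      _ ≤ L * (C ^ (i + 1) * dist (y₁, y₂) (w₁, w₂)) +
          L * (C ^ (i + 1) * dist (y₁, y₂) (w₁, w₂)) :=
        (norm_sub_le _ _).trans (add_le_add (h₁.trans (by gcongr)) (h₂.trans (by gcongr)))
      _ = _ := by ring

end Iterates

/-! ### Coordinates of the observer map -/

theorem matB_mulVec_apply (n p : ℕ) (v : Fin p → ℂ) (k : Fin (n + 1)) (j : Fin p) :
    (matB n p).mulVec v (finProdFinEquiv (k, j)) = v j := by
  simp [matB, Matrix.mulVec, dotProduct, Matrix.one_apply, Equiv.uniqueProd]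

theorem matA_mulVec_apply (n p : ℕ) (l : Fin (n + 1) → ℂ) (w : Fin ((n + 1) * p) → ℂ)
    (k : Fin (n + 1)) (j : Fin p) :
    (matA n p l).mulVec w (finProdFinEquiv (k, j)) = l k * w (finProdFinEquiv (k, j)) := by
  rw [Matrix.mulVec, dotProduct, ← finProdFinEquiv.sum_comp, Fintype.sum_prod_type]
  simp [matA, Matrix.one_apply, Matrix.diagonal_apply]

theorem matA_pow_mul_matB_mulVec_apply (n p : ℕ) (l : Fin (n + 1) → ℂ) (v : Fin p → ℂ) (i : ℕ)
    (k : Fin (n + 1)) (j : Fin p) :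
    (matA n p l ^ i * matB n p).mulVec v (finProdFinEquiv (k, j)) = l k ^ i * v j := by
  induction i with
  | zero => simp [matB_mulVec_apply]
  | succ i ih =>
    rw [pow_succ', Matrix.mul_assoc, ← Matrix.mulVec_mulVec, matA_mulVec_apply, ih, pow_succ',
      mul_assoc]

theorem seriesTerm_apply {n p : ℕ} (f : EuclideanSpace ℝ (Fin n) ≃ EuclideanSpace ℝ (Fin n))
    (h : EuclideanSpace ℝ (Fin n) → EuclideanSpace ℝ (Fin p)) (l : Fin (n + 1) → ℂ)
    (x : EuclideanSpace ℝ (Fin n)) (i : ℕ) (k : Fin (n + 1)) (j : Fin p) :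
    seriesTerm f h (matA n p l) (matB n p) x i (finProdFinEquiv (k, j)) =
      l k ^ i * complexify (h (f.symm^[i + 1] x)) j :=
  matA_pow_mul_matB_mulVec_apply n p l _ i k j

theorem summable_euclideanSpace_iff {ι : Type*} [Fintype ι] {u : ℕ → EuclideanSpace ℂ ι} :
    Summable u ↔ ∀ q, Summable fun i => u i q := by
  rw [← (EuclideanSpace.equiv ι ℂ).summable, Pi.summable]
  rfl

theorem lipschitzWith_complexify_apply {p : ℕ} (j : Fin p) :
    LipschitzWith 1 fun y : EuclideanSpace ℝ (Fin p) => complexify y j := by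
  refine LipschitzWith.of_dist_le_mul fun y y' => ?_
  rw [NNReal.coe_one, one_mul, dist_eq_norm, dist_eq_norm]
  simpa [complexify, ← Complex.ofReal_sub] using PiLp.norm_apply_le (y - y') j

theorem contDiff_complexify_apply {p : ℕ} (j : Fin p) :
    ContDiff ℝ 1 fun y : EuclideanSpace ℝ (Fin p) => complexify y j :=
  Complex.ofRealCLM.contDiff.comp (contDiff_piLp_apply 2 (i := j))

theorem exists_convex_mem_nhdsWithin {E : Type*} [NormedAddCommGroup E] [NormedSpace ℝ E]
    {Y : Set E} (hY : Convex ℝ Y ∨ IsOpen Y) {x : E} (hx : x ∈ Y) :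
    ∃ t ∈ 𝓝[Y] x, t ⊆ Y ∧ Convex ℝ t := by
  rcases hY with hY | hY
  · exact ⟨Y, self_mem_nhdsWithin, subset_rfl, hY⟩
  · obtain ⟨r, hr, hball⟩ := Metric.isOpen_iff.1 hY x hx
    exact ⟨ball x r, mem_nhdsWithin_of_mem_nhds (ball_mem_nhds x hr), hball, convex_ball x r⟩

theorem norm_fderiv_symm_le {n : ℕ} {f : EuclideanSpace ℝ (Fin n) ≃ EuclideanSpace ℝ (Fin n)}
    {Y : Set (EuclideanSpace ℝ (Fin n))} (hY : inverseDerivSup f Y ≠ ∞) :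
    ∀ x ∈ Y, ‖fderiv ℝ f.symm x‖ ≤ max 1 (inverseDerivSup f Y).toReal := by
  intro x hx
  refine le_max_of_le_right ?_
  rw [← toReal_enorm]
  exact ENNReal.toReal_mono hY (le_iSup₂ (f := fun x (_ : x ∈ Y) => ‖fderiv ℝ f.symm x‖ₑ) x hx)

theorem inverseDerivSup_ne_top {n : ℕ}
    {f : EuclideanSpace ℝ (Fin n) ≃ EuclideanSpace ℝ (Fin n)}
    {Y : Set (EuclideanSpace ℝ (Fin n))} {K : NNReal} (hf : LipschitzWith K f.symm) :
    inverseDerivSup f Y ≠ ∞ := by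
  refine ne_top_of_le_ne_top (ENNReal.coe_ne_top (r := K)) (iSup₂_le fun x _ => ?_)
  rw [← enorm_norm, ← ofReal_norm, norm_norm, ← ENNReal.ofReal_coe_nnreal]
  exact ENNReal.ofReal_le_ofReal (norm_fderiv_le_of_lipschitz ℝ hf)

/-- Replacing `C₂` by `max 1 C₂` turns both cases of the minimum, including `C₂ = 0`, into one real
radius. -/
theorem openDisc_eq_ball {C : ℝ≥0∞} (hC : C ≠ ∞) :
    openDisc C = ball 0 (1 / max 1 C.toReal) := by
  lift C to NNReal using hC
  have h : min 1 (1 / (C : ℝ≥0∞)) = ENNReal.ofReal (1 / max 1 (C : ℝ)) := by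
    rw [one_div, one_div, ENNReal.ofReal_inv_of_pos (by positivity), ENNReal.ofReal_max,
      ENNReal.ofReal_one, ENNReal.ofReal_coe_nnreal]
    rcases le_total (1 : ℝ≥0∞) C with h | h
    · rw [max_eq_right h, min_eq_right (ENNReal.inv_le_one.2 h)]
    · rw [max_eq_left h, min_eq_left (ENNReal.one_le_inv.2 h), inv_one]
  rw [openDisc, h, Metric.eball_ofReal, ENNReal.coe_toReal]

/-! ### The main theorem -/

theorem theorem3 (n p : ℕ)
    (f : EuclideanSpace ℝ (Fin n) ≃ EuclideanSpace ℝ (Fin n))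
    (h : EuclideanSpace ℝ (Fin n) → EuclideanSpace ℝ (Fin p))
    (hf_smooth : ContDiff ℝ 1 f.symm) (hf_lip : ∃ K, LipschitzWith K f.symm)
    (hh_smooth : ContDiff ℝ 1 h) (hh_lip : ∃ K, LipschitzWith K h)
    (X Y : Set (EuclideanSpace ℝ (Fin n)))
    (hX : BackwardDistinguishable f h X)
    (hXY : X ⊆ Y)
    (hY_back : ∀ x ∈ Y, f.symm x ∈ Y)
    (hY : Convex ℝ Y ∨ (IsOpen Y ∧ IsPreconnected Y)) :
    ∃ R : Set (Fin (n + 1) → ℂ),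
      R ⊆ {l | ∀ k, l k ∈ openDisc (inverseDerivSup f Y)} ∧
      volume R = 0 ∧
      ∀ l : Fin (n + 1) → ℂ, (∀ k, l k ∈ openDisc (inverseDerivSup f Y)) → l ∉ R →
        (∀ x ∈ Y, Summable (seriesTerm f h (matA n p l) (matB n p) x)) ∧
        ContDiffOn ℝ 1 (mapT f h (matA n p l) (matB n p)) Y ∧
        Set.InjOn (mapT f h (matA n p l) (matB n p)) X := by
  obtain ⟨K, hK⟩ := hf_lip
  obtain ⟨L, hL⟩ := hh_lip
  have hpre : IsPreconnected Y := hY.elim Convex.isPreconnected And.right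
  have hconv : ∀ x ∈ Y, ∃ t ∈ 𝓝[Y] x, t ⊆ Y ∧ Convex ℝ t := fun x hx =>
    exists_convex_mem_nhdsWithin (hY.imp_right And.left) hx
  have htop : inverseDerivSup f Y ≠ ∞ := inverseDerivSup_ne_top hK
  have hC := norm_fderiv_symm_le htop
  rw [openDisc_eq_ball htop]
  set C := max 1 (inverseDerivSup f Y).toReal
  have hC1 : 1 ≤ C := le_max_left _ _
  have hC0 : 0 < C := zero_lt_one.trans_le hC1
  have hg : Differentiable ℝ f.symm := hf_smooth.differentiable one_ne_zero
  have hηL : ∀ j : Fin p, LipschitzWith (1 * L) fun x => complexify (h x) j := fun j =>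
    (lipschitzWith_complexify_apply j).comp hL
  have hηC : ∀ j : Fin p, ContDiff ℝ 1 fun x => complexify (h x) j := fun j =>
    (contDiff_complexify_apply j).comp hh_smooth
  have hsumm : ∀ l : Fin (n + 1) → ℂ, (∀ k, l k ∈ ball (0 : ℂ) (1 / C)) → ∀ x ∈ Y, ∀ k j,
      Summable fun i => l k ^ i * complexify (h (f.symm^[i + 1] x)) j := by
    intro l hl x hx k j
    obtain ⟨M, hM⟩ := exists_norm_output_le hg hY_back hC hC1 hpre hconv (hηL j) hx
    exact (summable_norm_pow_mul_of_le hC0 hM (hl k)).of_norm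
  have hSumm : ∀ l : Fin (n + 1) → ℂ, (∀ k, l k ∈ ball (0 : ℂ) (1 / C)) → ∀ x ∈ Y,
      Summable (seriesTerm f h (matA n p l) (matB n p) x) := by
    intro l hl x hx
    refine summable_euclideanSpace_iff.2 (finProdFinEquiv.surjective.forall.2 ?_)
    rintro ⟨k, j⟩
    simpa only [seriesTerm_apply] using hsumm l hl x hx k j
  have hT : ∀ l : Fin (n + 1) → ℂ, (∀ k, l k ∈ ball (0 : ℂ) (1 / C)) → ∀ x ∈ Y, ∀ k j,
      mapT f h (matA n p l) (matB n p) x (finProdFinEquiv (k, j)) =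
        ∑' i, l k ^ i * complexify (h (f.symm^[i + 1] x)) j := by
    intro l hl x hx k j
    simp only [← seriesTerm_apply]
    exact (EuclideanSpace.proj (𝕜 := ℂ) (finProdFinEquiv (k, j))).map_tsum (hSumm l hl x hx)
  let F : Fin p → EuclideanSpace ℝ (Fin n) × EuclideanSpace ℝ (Fin n) → ℂ → ℂ := fun j x z =>
    ∑' i, z ^ i * (complexify (h (f.symm^[i + 1] x.1)) j - complexify (h (f.symm^[i + 1] x.2)) j)
  let s : Set (EuclideanSpace ℝ (Fin n) × EuclideanSpace ℝ (Fin n)) :=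
    {x | x.1 ∈ X ∧ x.2 ∈ X ∧ x.1 ≠ x.2}
  refine ⟨{l | (∀ k, l k ∈ ball (0 : ℂ) (1 / C)) ∧ ∃ x ∈ s, ∀ j k, F j x (l k) = 0},
    fun l hl => hl.1, ?_, fun l hl hlR => ⟨hSumm l hl, ?_, ?_⟩⟩
  · refine volume_common_zeros_eq_zero (fun j =>
      (holomorphicLipschitz_output_sub hg hY_back hC hC1 hpre hconv (hηL j)).mono
        fun x hx => ⟨hXY hx.1, hXY hx.2.1⟩) isOpen_ball ?_ (n + 1) ?_
    · rintro ⟨x₁, x₂⟩ ⟨hx₁, hx₂, hne⟩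
      obtain ⟨i, hi, hhi⟩ := hX x₁ hx₁ x₂ hx₂ hne
      -- Backward time `i + 1` is the coefficient of `z ^ i`; this is why distinguishability asks
      -- for positive times.
      obtain ⟨i, rfl⟩ := Nat.exists_eq_add_one_of_ne_zero hi.ne'
      obtain ⟨j, hj⟩ : ∃ j, h (f.symm^[i + 1] x₁) j ≠ h (f.symm^[i + 1] x₂) j := by
        by_contra! hcon
        exact hhi (PiLp.ext hcon)
      obtain ⟨M₁, h₁⟩ := exists_norm_output_le hg hY_back hC hC1 hpre hconv (hηL j) (hXY hx₁)
      obtain ⟨M₂, h₂⟩ := exists_norm_output_le hg hY_back hC hC1 hpre hconv (hηL j) (hXY hx₂)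
      refine ⟨j, fun z hz => exists_iterate_deriv_tsum_ne_zero (M := M₁ + M₂) hC0 (fun i =>
        (norm_sub_le _ _).trans ((add_le_add (h₁ i) (h₂ i)).trans_eq (by ring))) (k := i) ?_ hz⟩
      rw [sub_ne_zero]
      simpa [complexify] using hj
    -- The dimension count `2n < 2(n+1)`: this is where `n + 1` eigenvalues are needed.
    · rw [Module.finrank_prod, finrank_euclideanSpace_fin]
      omega
  · refine contDiffOn_piLp' 2 (finProdFinEquiv.surjective.forall.2 ?_)
    rintro ⟨k, j⟩
    exact (contDiffOn_tsum_output hf_smooth hY_back hC hC1 hpre hconv (hηL j) (hηC j)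
      (hl k)).congr fun x hx => hT l hl x hx k j
  · intro x₁ hx₁ x₂ hx₂ heq
    by_contra hne
    refine hlR ⟨hl, (x₁, x₂), ⟨hx₁, hx₂, hne⟩, fun j k => ?_⟩
    simp only [F, mul_sub]
    rw [(hsumm l hl x₁ (hXY hx₁) k j).tsum_sub (hsumm l hl x₂ (hXY hx₂) k j),
      ← hT l hl x₁ (hXY hx₁), ← hT l hl x₂ (hXY hx₂), heq, sub_self]
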